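/- Terms are built from a finite signature (function symbols with arities) and a countably infinite set of variables; the size $|t|$ of a term $t$ is the number of occurrences of function symbols and variables in $t$. A term rewriting system (TRS) is a finite set $R$ of rules $l\to r$ such that $l$ is not a variable and every variable of $r$ occurs in $l$; $\to_R$ is the induced one-step rewrite relation on terms and $\to_R^*$ its reflexive and transitive closure. $R$ is confluent if, whenever $s\to_R^* s_1$ and $s\to_R^* s_2$, there is a term $t$ with $s_1\to_R^* t$ and $s_2\to_R^* t$; it is terminating if there is no infinite sequence $t_0\to_R t_1\to_R t_2\to_R\cdots$. The small term reachability problem for $R$ is: given a term $s$ and a natural number $n$, decide whether there is a term $t$ with $s\to_R^* t$ and $|t|\le n$. Proposition. (1) There is a (fixed) confluent TRS $R$ for which the small term reachability problem is undecidable. (2) If $R$ is a terminating TRS, then for every term $s$ the set $\{t : s\to_R^* t\}$ is finite, and the small term reachability problem for $R$ is decidable. (3) The decision in (2) is uniform in $R$: there is a single algorithm that, on input a signature, a terminating TRS $R$ over it, a term $s$ and a natural number $n$, halts and answers correctly whether some term $t$ with $|t|\le n$ satisfies $s\to_R^* t$. -/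

import Mathlib

namespace TermRewriting

/-- Terms over the function symbols of `L`, with the countably infinite set `ℕ` of variables. -/
abbrev Tm (L : FirstOrder.Language.{0, 0}) : Type := L.Term ℕ

/-- The size `|t|`: the number of occurrences of function symbols and variables in `t`. -/
def termSize {L : FirstOrder.Language.{0, 0}} : Tm L → ℕ
  | FirstOrder.Language.Term.var _ => 1
  | FirstOrder.Language.Term.func _ ts => 1 + ∑ i, termSize (ts i)

/-- A term rewriting system: finitely many rules `l → r` such that `l` is not a variable and every
variable of `r` occurs in `l`.  (The finite set of rules is given by listing its elements.) -/
structure TRS (L : FirstOrder.Language.{0, 0}) where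
  rules : List (Tm L × Tm L)
  lhs_ne_var : ∀ ρ ∈ rules, ∀ x : ℕ, ρ.1 ≠ FirstOrder.Language.Term.var x
  vars_subset : ∀ ρ ∈ rules, ρ.2.varFinset ⊆ ρ.1.varFinset

namespace TRS

variable {L : FirstOrder.Language.{0, 0}}

/-- The one-step rewrite relation `s →_R t`: one subterm of `s` that is an instance of the left-hand
side of a rule is replaced by the corresponding instance of the right-hand side. -/
inductive Step (R : TRS L) : Tm L → Tm L → Prop
  | rule (ρ : Tm L × Tm L) (hρ : ρ ∈ R.rules) (θ : ℕ → Tm L) :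
      Step R (ρ.1.subst θ) (ρ.2.subst θ)
  | arg {k : ℕ} (f : L.Functions k) (ts : Fin k → Tm L) (i : Fin k) (t : Tm L)
      (h : Step R (ts i) t) :
      Step R (FirstOrder.Language.Term.func f ts)
        (FirstOrder.Language.Term.func f (Function.update ts i t))

/-- `s →*_R t`, the reflexive and transitive closure of `→_R`. -/
def Reaches (R : TRS L) : Tm L → Tm L → Prop := Relation.ReflTransGen R.Step

def Joinable (R : TRS L) (s₁ s₂ : Tm L) : Prop := ∃ t, R.Reaches s₁ t ∧ R.Reaches s₂ t

def Confluent (R : TRS L) : Prop :=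
  ∀ s s₁ s₂, R.Reaches s s₁ → R.Reaches s s₂ → R.Joinable s₁ s₂

def Terminating (R : TRS L) : Prop := ¬ ∃ t : ℕ → Tm L, ∀ i, R.Step (t i) (t (i + 1))

/-- The question asked by the small term reachability problem for `R` on the input `s`, `n`. -/
def SmallTermReachable (R : TRS L) (s : Tm L) (n : ℕ) : Prop :=
  ∃ t, R.Reaches s t ∧ termSize t ≤ n

end TRS

/-- The finite signature with function symbols `0, …, σ.length - 1`, the `i`-th of arity `σ[i]`. -/
def sig (σ : List ℕ) : FirstOrder.Language.{0, 0} where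
  Functions k := {i : Fin σ.length // σ.get i = k}
  Relations _ := Empty

/-- Words over the alphabet of variables (`Sum.inl x`) and function symbols (`Sum.inr i`). -/
abbrev Word : Type := List (ℕ ⊕ ℕ)

/-- A term as input of an algorithm: the word that writes it in prefix (Polish) notation. -/
def encodeTerm {σ : List ℕ} (t : Tm (sig σ)) : Word :=
  t.listEncode.map (Sum.map id fun f => (f.2.1 : ℕ))

/-- A TRS as input of an algorithm: the list of its rules, with terms as words. -/
def TRS.encode {σ : List ℕ} (R : TRS (sig σ)) : List (Word × Word) :=
  R.rules.map fun ρ => (encodeTerm ρ.1, encodeTerm ρ.2)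

/-- The small term reachability problem for the fixed system `R` is decidable: the set of all
`(w, n)` such that `w` is a term from which a term of size at most `n` is reachable is recursive. -/
def TRS.SmallTermReachabilityDecidable {σ : List ℕ} (R : TRS (sig σ)) : Prop :=
  ComputablePred fun p : Word × ℕ => ∃ s, encodeTerm s = p.1 ∧ R.SmallTermReachable s p.2

end TermRewriting

/-! For the negative part, an abstract machine evaluating `Turing.ToPartrec.Code` is written as a
rewrite system whose configurations have root `run`, `ret` or `done`, the constant `done` being
reached on halting. Three further rules collapse any term with such a root to the normal form
`stuck`. This collapse forces confluence (`Machine.confluent_system`): reducts of a term with one of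
these roots join at `stuck`, and below any other root rewriting happens argumentwise. As `done` has
size 1 and `stuck` size 2, a term of size at most 1 is reachable from a start configuration exactly
when the computation halts (`Machine.smallTermReachable_iff`).

For the positive parts, terms are handled as words in Polish notation. This is a prefix code, so
rewrite steps are exactly replacements of factors of the word, and a variable of a matched left-hand
side is instantiated by a factor of the word. Hence the finite list of one-step reducts is primitive
recursive, uniformly in the signature and the rules (`mem_reducts_encode`, `primrec_reducts`).
Finite branching and well-foundedness make some level of the reduction tree empty
(`TRS.Terminating.exists_reductLevel_eq_nil`), so there are finitely many reducts and breadth-first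
search halts. -/

namespace TermRewriting

/-! ### Terms as words in Polish notation: unique reading and recognition -/

section Words

open FirstOrder.Language

theorem List.ofFn_update_eq_set {α : Type*} {k : ℕ} (f : Fin k → α) (i : Fin k) (x : α) :
    List.ofFn (Function.update f i x) = (List.ofFn f).set i x := by
  apply List.ext_getElem
  · simp
  · intro j h₁ h₂
    simp only [List.getElem_ofFn, List.getElem_set, Function.update_apply, Fin.ext_iff]
    simp only [eq_comm]

theorem List.exists_ofFn_update {α : Type*} {k : ℕ} (f : Fin k → α) (i : Fin k) :
    ∃ p q : List α, ∀ x, List.ofFn (Function.update f i x) = p ++ x :: q := by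
  refine ⟨(List.ofFn f).take i, (List.ofFn f).drop (i + 1), fun x => ?_⟩
  rw [List.ofFn_update_eq_set, List.set_eq_take_append_cons_drop, if_pos (by simp)]

theorem List.exists_update_of_ofFn_eq {α : Type*} {k : ℕ} {f : Fin k → α} {p q : List α} {x : α}
    (h : List.ofFn f = p ++ x :: q) :
    ∃ i, f i = x ∧ ∀ y, List.ofFn (Function.update f i y) = p ++ y :: q := by
  have hk : k = p.length + (q.length + 1) := by simpa using congrArg List.length h
  refine ⟨⟨p.length, by omega⟩, ?_, fun y => ?_⟩
  · have : (List.ofFn f)[p.length]? = some x := by rw [h]; simp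
    rw [List.getElem?_ofFn, dif_pos (by omega)] at this
    exact Option.some.inj this
  · rw [List.ofFn_update_eq_set, h]
    simp

variable {σ : List ℕ}

theorem encodeTerm_var (x : ℕ) : encodeTerm (Term.var x : Tm (sig σ)) = [Sum.inl x] := rfl

theorem encodeTerm_func {k : ℕ} (f : (sig σ).Functions k) (ts : Fin k → Tm (sig σ)) :
    encodeTerm (Term.func f ts) = Sum.inr (f.1 : ℕ) :: (List.ofFn ts).flatMap encodeTerm := by
  simp only [encodeTerm, Term.listEncode, List.map_cons, List.map_flatMap, List.ofFn_eq_map,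
    List.flatMap_map]
  rfl

theorem encodeTerm_ne_nil (t : Tm (sig σ)) : encodeTerm t ≠ [] := by
  cases t with
  | var x => simp [encodeTerm_var]
  | func f ts => simp [encodeTerm_func]

theorem length_encodeTerm (t : Tm (sig σ)) : (encodeTerm t).length = termSize t := by
  induction t with
  | var x => rfl
  | func f ts ih =>
    simp [encodeTerm_func, termSize, List.length_flatMap, ih, List.sum_ofFn, Function.comp_def,
      List.map_ofFn, add_comm]

/-- Unique reading is assumed only for the members of `ts`, so that this can serve inside the
induction on terms that proves it. -/
theorem flatMap_prefix_unique {ts ts' : List (Tm (sig σ))}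
    (ih : ∀ t ∈ ts, ∀ (t' : Tm (sig σ)) (w w' : Word),
      encodeTerm t ++ w = encodeTerm t' ++ w' → t = t' ∧ w = w')
    (hl : ts.length = ts'.length) {w w' : Word}
    (h : ts.flatMap encodeTerm ++ w = ts'.flatMap encodeTerm ++ w') : ts = ts' ∧ w = w' := by
  induction ts generalizing ts' with
  | nil =>
    obtain rfl : ts' = [] := List.length_eq_zero_iff.1 hl.symm
    simpa using h
  | cons t ts ih' =>
    cases ts' with
    | nil => simp at hl
    | cons t' ts' =>
      simp only [List.flatMap_cons, List.append_assoc] at h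
      obtain ⟨rfl, h'⟩ := ih t (by simp) t' _ _ h
      obtain ⟨rfl, rfl⟩ := ih' (fun s hs => ih s (List.mem_cons_of_mem _ hs)) (by simpa using hl) h'
      exact ⟨rfl, rfl⟩

/-- The first letter fixes the root symbol, hence its arity, hence how many arguments have to be
read from the rest. -/
theorem encodeTerm_prefix_unique {t t' : Tm (sig σ)} {w w' : Word}
    (h : encodeTerm t ++ w = encodeTerm t' ++ w') : t = t' ∧ w = w' := by
  induction t generalizing t' w w' with
  | var x =>
    cases t' with
    | var y => simpa [encodeTerm_var] using h
    | func f ts => simp [encodeTerm_var, encodeTerm_func] at h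
  | func f ts ih =>
    cases t' with
    | var y => simp [encodeTerm_var, encodeTerm_func] at h
    | func g us =>
      simp only [encodeTerm_func, List.cons_append, List.cons.injEq, Sum.inr.injEq] at h
      obtain ⟨h₁, h₂⟩ := h
      have h₁ := Fin.ext h₁
      obtain rfl := (f.2.symm.trans (congrArg σ.get h₁)).trans g.2
      obtain rfl : f = g := Subtype.ext h₁
      obtain ⟨h₃, rfl⟩ := flatMap_prefix_unique (by
        intro t ht t' w w' h
        obtain ⟨i, rfl⟩ := (List.mem_ofFn' _ _).1 ht
        exact ih i h) (by simp) h₂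
      obtain rfl := List.ofFn_injective h₃
      exact ⟨rfl, rfl⟩

theorem encodeTerm_injective : Function.Injective (encodeTerm : Tm (sig σ) → Word) := by
  intro t t' h
  exact (encodeTerm_prefix_unique (w := []) (w' := []) (by rw [h])).1

theorem encodeTerm_subst (t : Tm (sig σ)) (θ : ℕ → Tm (sig σ)) :
    encodeTerm (t.subst θ) =
      (encodeTerm t).flatMap (Sum.elim (fun x => encodeTerm (θ x)) fun i => [Sum.inr i]) := by
  induction t with
  | var x => simp [encodeTerm_var]
  | func f ts ih =>
    simp only [Term.subst, encodeTerm_func, List.flatMap_cons, Sum.elim_inr, List.cons_append,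
      List.nil_append, List.ofFn_eq_map, List.flatMap_map, List.flatMap_assoc, ih]

theorem inl_mem_encodeTerm {t : Tm (sig σ)} {x : ℕ} :
    Sum.inl x ∈ encodeTerm t ↔ x ∈ t.varFinset := by
  induction t with
  | var y => simp [encodeTerm_var]
  | func f ts ih => simp [encodeTerm_func, ih]

/-- One step of the right-to-left scan `countTerms`. -/
def countStep (σ : List ℕ) (s : ℕ ⊕ ℕ) (o : Option ℕ) : Option ℕ :=
  Sum.casesOn s (fun _ => o.map Nat.succ) fun i =>
    o.bind fun c => (σ[i]?).bind fun k => if k ≤ c then some (c - k + 1) else none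

/-- The number of terms of which the word `w` is the concatenation, if there is one. -/
def countTerms (σ : List ℕ) (w : Word) : Option ℕ := w.foldr (countStep σ) (some 0)

/-- An arbitrary start value `n` stands for terms already scanned further to the right; the
induction through the arguments needs it. -/
theorem foldr_countStep_encodeTerm (t : Tm (sig σ)) (n : ℕ) :
    (encodeTerm t).foldr (countStep σ) (some n) = some (n + 1) := by
  induction t generalizing n with
  | var x => rfl
  | func f ts ih =>
    have hts : ∀ us : List (Tm (sig σ)), (∀ u ∈ us, ∃ i, ts i = u) →
        (us.flatMap encodeTerm).foldr (countStep σ) (some n) = some (n + us.length) := by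
      intro us hus
      induction us with
      | nil => rfl
      | cons u us ih' =>
        obtain ⟨i, rfl⟩ := hus u (by simp)
        rw [List.flatMap_cons, List.foldr_append, ih' fun u hu => hus u (by simp [hu]), ih]
        rfl
    have hf : σ[(f.1 : ℕ)]? = some _ := List.getElem?_eq_some_iff.2 ⟨f.1.2, f.2⟩
    rw [encodeTerm_func, List.foldr_cons, hts _ fun u hu => (List.mem_ofFn' _ _).1 hu]
    simp only [countStep, Option.bind_some, hf]
    simp

theorem countTerms_encodeTerm (t : Tm (sig σ)) : countTerms σ (encodeTerm t) = some 1 :=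
  foldr_countStep_encodeTerm t 0

/-- The scan acts as a stack of terms: a variable is pushed, and a symbol of arity `k` takes the
first `k` terms as its arguments. -/
theorem exists_terms_of_countTerms {w : Word} {m : ℕ} (h : countTerms σ w = some m) :
    ∃ ts : List (Tm (sig σ)), ts.length = m ∧ ts.flatMap encodeTerm = w := by
  induction w generalizing m with
  | nil =>
    obtain rfl : 0 = m := by simpa [countTerms] using h
    exact ⟨[], rfl, rfl⟩
  | cons s w ih =>
    change countStep σ s (countTerms σ w) = some m at h
    cases s with
    | inl x =>
      simp only [countStep, Option.map_eq_some_iff] at h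
      obtain ⟨c, hc, rfl⟩ := h
      obtain ⟨ts, rfl, rfl⟩ := ih hc
      exact ⟨Term.var x :: ts, rfl, rfl⟩
    | inr i =>
      simp only [countStep, Option.bind_eq_some_iff] at h
      obtain ⟨c, hc, k, hk, h⟩ := h
      obtain ⟨ts, rfl, rfl⟩ := ih hc
      split_ifs at h with hkc
      obtain ⟨hi, rfl⟩ := List.getElem?_eq_some_iff.1 hk
      obtain rfl := Option.some.inj h
      have hts : List.ofFn (fun j : Fin σ[i] => ts[j.1]'(by omega)) = ts.take σ[i] := by
        apply List.ext_getElem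
        · simpa using hkc
        · intro j h₁ h₂
          simp
      let f : (sig σ).Functions σ[i] := ⟨⟨i, hi⟩, rfl⟩
      refine ⟨Term.func f (fun j => ts[j.1]'(by omega)) :: ts.drop σ[i], by simp, ?_⟩
      rw [List.flatMap_cons, encodeTerm_func, List.cons_append, ← List.flatMap_append, hts,
        List.take_append_drop]

theorem countTerms_eq_one_iff {w : Word} :
    countTerms σ w = some 1 ↔ ∃ t : Tm (sig σ), encodeTerm t = w := by
  constructor
  · intro h
    obtain ⟨ts, hl, rfl⟩ := exists_terms_of_countTerms h
    obtain ⟨t, rfl⟩ := List.length_eq_one_iff.1 hl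
    exact ⟨t, by simp⟩
  · rintro ⟨t, rfl⟩
    exact countTerms_encodeTerm t

end Words

/-! ### Rewrite steps as replacements of factors -/

namespace TRS

open FirstOrder.Language

variable {σ : List ℕ}

theorem Step.exists_factor {R : TRS (sig σ)} {t t' : Tm (sig σ)} (h : R.Step t t') :
    ∃ ρ ∈ R.rules, ∃ (θ : ℕ → Tm (sig σ)) (a b : Word),
      encodeTerm t = a ++ encodeTerm (ρ.1.subst θ) ++ b ∧
      encodeTerm t' = a ++ encodeTerm (ρ.2.subst θ) ++ b := by
  induction h with
  | rule ρ hρ θ => exact ⟨ρ, hρ, θ, [], [], by simp, by simp⟩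
  | arg f ts i t h ih =>
    obtain ⟨ρ, hρ, θ, a, b, h₁, h₂⟩ := ih
    obtain ⟨p, q, hpq⟩ := List.exists_ofFn_update ts i
    refine ⟨ρ, hρ, θ, Sum.inr (f.1 : ℕ) :: (p.flatMap encodeTerm ++ a),
      b ++ q.flatMap encodeTerm, ?_, ?_⟩
    · have := hpq (ts i)
      rw [Function.update_eq_self] at this
      simp [encodeTerm_func, this, h₁]
    · simp [encodeTerm_func, hpq, h₂]

/-- A factor that is itself a term can only be a subterm. The induction strips `a` letter by letter;
stripping a function symbol leaves its arguments in front of the remaining terms, which is why the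
claim concerns lists of terms. -/
theorem Step.exists_of_factor_list {R : TRS (sig σ)} {u u' : Tm (sig σ)} (h : R.Step u u')
    {a b : Word} {ts : List (Tm (sig σ))}
    (hts : a ++ encodeTerm u ++ b = ts.flatMap encodeTerm) :
    ∃ p t t' q, ts = p ++ t :: q ∧ R.Step t t' ∧
      a ++ encodeTerm u' ++ b = (p ++ t' :: q).flatMap encodeTerm := by
  induction a generalizing ts with
  | nil =>
    cases ts with
    | nil => simp [encodeTerm_ne_nil] at hts
    | cons t ts =>
      obtain ⟨rfl, rfl⟩ := encodeTerm_prefix_unique (by simpa using hts)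
      exact ⟨[], u, u', ts, by simp, h, by simp⟩
  | cons s a ih =>
    cases ts with
    | nil => simp at hts
    | cons t ts =>
      cases t with
      | var x =>
        simp only [List.cons_append, List.flatMap_cons, encodeTerm_var, List.cons.injEq,
          List.nil_append] at hts
        obtain ⟨rfl, hts⟩ := hts
        obtain ⟨p, t, t', q, rfl, ht, h'⟩ := ih hts
        exact ⟨Term.var x :: p, t, t', q, by simp, ht, by
          simp only [List.cons_append, List.flatMap_cons, encodeTerm_var, List.nil_append, h']⟩
      | func f args =>
        simp only [List.cons_append, List.flatMap_cons, encodeTerm_func, List.cons.injEq,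
          ← List.flatMap_append] at hts
        obtain ⟨rfl, hts⟩ := hts
        obtain ⟨p, t, t', q, hpq, ht, h'⟩ := ih hts
        -- The rewritten term lies either behind all the arguments of `f` or among them.
        have key : (∃ p', p = List.ofFn args ++ p' ∧ ts = p' ++ t :: q) ∨
            ∃ q', List.ofFn args = p ++ t :: q' ∧ q = q' ++ ts := by
          rcases List.append_eq_append_iff.1 hpq with ⟨p', h₁, h₂⟩ | ⟨q', h₁, h₂⟩
          · exact .inl ⟨p', h₁, h₂⟩
          · cases q' with
            | nil => exact .inl ⟨[], by simpa using h₁.symm, by simpa using h₂.symm⟩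
            | cons s q' =>
              simp only [List.cons_append, List.cons.injEq] at h₂
              obtain ⟨rfl, rfl⟩ := h₂
              exact .inr ⟨q', h₁, rfl⟩
        rcases key with ⟨p', rfl, rfl⟩ | ⟨q', h₁, rfl⟩
        · refine ⟨Term.func f args :: p', t, t', q, by simp, ht, ?_⟩
          simp only [List.cons_append, h', List.flatMap_cons, encodeTerm_func,
            List.flatMap_append, List.append_assoc]
        · obtain ⟨i, rfl, hi⟩ := List.exists_update_of_ofFn_eq h₁
          refine ⟨[], Term.func f args, Term.func f (Function.update args i t'), ts, by simp,
            Step.arg f args i t' ht, ?_⟩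
          simp only [List.cons_append, h', List.flatMap_cons, encodeTerm_func, hi,
            List.flatMap_append, List.append_assoc, List.nil_append]

theorem Step.exists_of_factor {R : TRS (sig σ)} {u u' t : Tm (sig σ)} (h : R.Step u u')
    {a b : Word} (ht : encodeTerm t = a ++ encodeTerm u ++ b) :
    ∃ t', R.Step t t' ∧ encodeTerm t' = a ++ encodeTerm u' ++ b := by
  obtain ⟨p, s, s', q, h₁, hs, h₂⟩ :=
    h.exists_of_factor_list (a := a) (b := b) (ts := [t]) (by simp [ht])
  cases p with
  | nil =>
    simp only [List.nil_append, List.cons.injEq] at h₁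
    obtain ⟨rfl, rfl⟩ := h₁
    exact ⟨s', hs, by simp [h₂]⟩
  | cons _ p => simp at h₁

end TRS

/-! ### Enumeration of one-step reducts on words -/

/-- All factors of the word `w`. -/
def factors (w : Word) : List Word :=
  (List.range (w.length + 1)).flatMap fun i =>
    (List.range (w.length + 1)).map fun j => (w.drop i).take j

/-- The factors of `w` that are terms. -/
def termFactors (σ : List ℕ) (w : Word) : List Word :=
  (factors w).filter fun u => countTerms σ u = some 1

/-- The variables that occur in a word. -/
def wordVars (w : Word) : List ℕ :=
  w.filterMap fun c => Sum.casesOn c some fun _ => none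

/-- All association lists that assign a candidate to every variable in the list `l`. -/
def assignments (cands : List Word) (l : List ℕ) : List (List (ℕ × Word)) :=
  l.foldr (fun c acc => acc.flatMap fun θ => cands.map fun u => (c, u) :: θ) [[]]

/-- Substitution of words for variables, on words. -/
def substWord (θ : List (ℕ × Word)) (w : Word) : Word :=
  w.flatMap fun c => Sum.casesOn c (fun x => (θ.lookup x).getD [Sum.inl x]) fun i => [Sum.inr i]

/-- All words obtained from `w` by replacing one occurrence of `u` by `u'`. -/
def replacements (w u u' : Word) : List Word :=
  (List.range (w.length + 1)).flatMap fun i =>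
    if (w.drop i).take u.length = u then [w.take i ++ u' ++ w.drop (i + u.length)] else []

/-- All one-step reducts of the term `w`. -/
def reducts (σ : List ℕ) (rules : List (Word × Word)) (w : Word) : List Word :=
  rules.flatMap fun ρ => (assignments (termFactors σ w) (wordVars ρ.1)).flatMap fun θ =>
    replacements w (substWord θ ρ.1) (substWord θ ρ.2)

section Reducts

open FirstOrder.Language

variable {σ : List ℕ}

theorem mem_factors {u w : Word} : u ∈ factors w ↔ u <:+: w := by
  constructor
  · simp only [factors, List.mem_flatMap, List.mem_map, forall_exists_index, and_imp]
    rintro i - j - rfl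
    exact (List.take_prefix _ _).isInfix.trans (List.drop_suffix _ _).isInfix
  · rintro ⟨a, b, rfl⟩
    simp only [factors, List.mem_flatMap, List.mem_map, List.mem_range]
    exact ⟨a.length, by simp, u.length, by simp; omega, by simp⟩

theorem mem_termFactors {u w : Word} :
    u ∈ termFactors σ w ↔ u <:+: w ∧ ∃ t : Tm (sig σ), encodeTerm t = u := by
  simp [termFactors, mem_factors, countTerms_eq_one_iff]

theorem mem_wordVars {x : ℕ} {w : Word} : x ∈ wordVars w ↔ Sum.inl x ∈ w := by
  simp only [wordVars, List.mem_filterMap]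
  constructor
  · rintro ⟨y | i, hy, h⟩
    · obtain rfl := Option.some.inj h
      exact hy
    · cases h
  · exact fun h => ⟨_, h, rfl⟩

theorem snd_mem_of_mem_assignments {cands : List Word} {l : List ℕ} {θ : List (ℕ × Word)}
    (h : θ ∈ assignments cands l) : ∀ p ∈ θ, p.2 ∈ cands := by
  induction l generalizing θ with
  | nil =>
    obtain rfl : θ = [] := by simpa [assignments] using h
    simp
  | cons c l ih =>
    change θ ∈ (assignments cands l).flatMap _ at h
    simp only [List.mem_flatMap, List.mem_map] at h
    obtain ⟨θ', hθ', u, hu, rfl⟩ := h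
    simpa [hu] using ih hθ'

theorem map_mem_assignments {cands : List Word} {l : List ℕ} {Θ : ℕ → Word}
    (h : ∀ c ∈ l, Θ c ∈ cands) : (l.map fun c => (c, Θ c)) ∈ assignments cands l := by
  induction l with
  | nil => simp [assignments]
  | cons c l ih =>
    change _ ∈ (assignments cands l).flatMap _
    simp only [List.mem_flatMap, List.mem_map]
    exact ⟨_, ih fun c hc => h c (by simp [hc]), Θ c, h c (by simp), rfl⟩

theorem lookup_map_pair {α β : Type*} [BEq α] [LawfulBEq α] (f : α → β) {l : List α} {c : α}
    (h : c ∈ l) : (l.map fun c => (c, f c)).lookup c = some (f c) := by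
  induction l with
  | nil => simp at h
  | cons d l ih =>
    by_cases hcd : c = d
    · subst hcd; simp
    · rw [List.map_cons, List.lookup_cons, beq_false_of_ne hcd]
      exact ih (by simpa [hcd] using h)

theorem mem_of_lookup_eq_some {α β : Type*} [BEq α] [LawfulBEq α] {l : List (α × β)} {a : α} {b : β}
    (h : l.lookup a = some b) : (a, b) ∈ l := by
  induction l with
  | nil => simp at h
  | cons p l ih =>
    obtain ⟨d, e⟩ := p
    by_cases hcd : a = d
    · subst hcd
      obtain rfl : e = b := by simpa using h
      simp
    · rw [List.lookup_cons, beq_false_of_ne hcd] at h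
      exact List.mem_cons_of_mem _ (ih h)

theorem mem_replacements {w u u' v : Word} :
    v ∈ replacements w u u' ↔ ∃ a b, w = a ++ u ++ b ∧ v = a ++ u' ++ b := by
  simp only [replacements, List.mem_flatMap, List.mem_range]
  constructor
  · rintro ⟨i, -, h⟩
    split_ifs at h with hi
    · refine ⟨_, _, ?_, by simpa using h⟩
      conv_lhs => rw [← List.take_append_drop i w, ← List.take_append_drop u.length (w.drop i), hi]
      simp
    · simp at h
  · rintro ⟨a, b, rfl, rfl⟩
    exact ⟨a.length, by simp, by simp [← List.drop_drop]⟩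

/-- Whatever the list, it acts as one substitution: `lookup` reads only the first entry for a
variable, and a variable without entry stands for itself. -/
theorem exists_subst_of_terms {θ : List (ℕ × Word)}
    (h : ∀ p ∈ θ, ∃ t : Tm (sig σ), encodeTerm t = p.2) :
    ∃ Θ : ℕ → Tm (sig σ), ∀ t : Tm (sig σ),
      substWord θ (encodeTerm t) = encodeTerm (t.subst Θ) := by
  have : ∀ x : ℕ, ∃ t : Tm (sig σ),
      encodeTerm t = (θ.lookup x).getD [Sum.inl x] := by
    intro x
    cases hx : θ.lookup x with
    | none => exact ⟨Term.var x, rfl⟩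
    | some u => exact h _ (mem_of_lookup_eq_some hx)
  choose Θ hΘ using this
  refine ⟨Θ, fun t => ?_⟩
  rw [encodeTerm_subst, substWord]
  congr 1
  funext c
  cases c with
  | inl x => simp [hΘ]
  | inr i => simp

/-- Candidates from the factors of the word suffice: the value of a variable of the left-hand side
is a subterm of the redex, and the right-hand side has no other variables. -/
theorem mem_reducts_encode {R : TRS (sig σ)} {t : Tm (sig σ)} {w : Word} :
    w ∈ reducts σ R.encode (encodeTerm t) ↔ ∃ t', R.Step t t' ∧ encodeTerm t' = w := by
  simp only [reducts, TRS.encode, List.mem_flatMap, List.mem_map]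
  constructor
  · rintro ⟨_, ⟨ρ, hρ, rfl⟩, θ, hθ, hw⟩
    obtain ⟨Θ, hΘ⟩ := exists_subst_of_terms (σ := σ) fun p hp =>
      (mem_termFactors.1 (snd_mem_of_mem_assignments hθ p hp)).2
    obtain ⟨a, b, h₁, rfl⟩ := mem_replacements.1 hw
    rw [hΘ] at h₁
    obtain ⟨t', ht', h₂⟩ := (TRS.Step.rule ρ hρ Θ).exists_of_factor h₁
    exact ⟨t', ht', by rw [h₂, hΘ]⟩
  · rintro ⟨t', h, rfl⟩
    obtain ⟨ρ, hρ, θ, a, b, h₁, h₂⟩ := h.exists_factor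
    refine ⟨_, ⟨ρ, hρ, rfl⟩, (wordVars (encodeTerm ρ.1)).map fun x => (x, encodeTerm (θ x)), ?_, ?_⟩
    · refine map_mem_assignments fun x hx => mem_termFactors.2 ⟨?_, θ x, rfl⟩
      rw [h₁]
      refine List.IsInfix.trans ?_ ⟨a, b, rfl⟩
      rw [encodeTerm_subst]
      obtain ⟨p, q, hpq⟩ := List.append_of_mem (mem_wordVars.1 hx)
      rw [show encodeTerm ρ.1 = _ from hpq, List.flatMap_append, List.flatMap_cons,
        ← List.append_assoc]
      exact List.infix_append _ _ _
    -- The association list covers the variables of the left-hand side only; `vars_subset` lets this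
    -- apply to the right-hand side as well.
    · have key : ∀ s : Tm (sig σ), s.varFinset ⊆ ρ.1.varFinset →
          substWord ((wordVars (encodeTerm ρ.1)).map fun x => (x, encodeTerm (θ x)))
            (encodeTerm s) = encodeTerm (s.subst θ) := by
        intro s hs
        rw [encodeTerm_subst, substWord]
        refine List.flatMap_congr fun c hc => ?_
        cases c with
        | inr i => rfl
        | inl x =>
          have := lookup_map_pair (fun x => encodeTerm (θ x))
            (mem_wordVars.2 (inl_mem_encodeTerm.2 (hs (inl_mem_encodeTerm.1 hc))))
          simp only [this, Option.getD_some, Sum.elim_inl]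
      rw [key _ subset_rfl, key _ (R.vars_subset ρ hρ)]
      exact mem_replacements.2 ⟨a, b, h₁, h₂⟩

end Reducts

/-! ### Primitive recursiveness of the enumeration -/

section Primrec

theorem primrec_countStep :
    Primrec fun q : List ℕ × (ℕ ⊕ ℕ) × Option ℕ => countStep q.1 q.2.1 q.2.2 := by
  have hvar : Primrec₂ fun (q : List ℕ × (ℕ ⊕ ℕ) × Option ℕ) (_ : ℕ) => q.2.2.map Nat.succ :=
    Primrec.option_map (Primrec.snd.comp (Primrec.snd.comp Primrec.fst))
      (Primrec.succ.comp Primrec.snd).to₂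
  have hle : Primrec₂ fun (q : ((List ℕ × (ℕ ⊕ ℕ) × Option ℕ) × ℕ) × ℕ) (k : ℕ) =>
      if k ≤ q.2 then some (q.2 - k + 1) else none :=
    Primrec.ite (Primrec.nat_le.comp Primrec.snd (Primrec.snd.comp Primrec.fst))
      (Primrec.option_some.comp (Primrec.succ.comp (Primrec.nat_sub.comp
        (Primrec.snd.comp Primrec.fst) Primrec.snd))) (Primrec.const none)
  have hget : Primrec fun q : ((List ℕ × (ℕ ⊕ ℕ) × Option ℕ) × ℕ) × ℕ => q.1.1.1[q.1.2]? :=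
    Primrec.list_getElem?.comp (Primrec.fst.comp (Primrec.fst.comp Primrec.fst))
      (Primrec.snd.comp Primrec.fst)
  have hfun : Primrec₂ fun (q : List ℕ × (ℕ ⊕ ℕ) × Option ℕ) (i : ℕ) =>
      q.2.2.bind fun c => (q.1[i]?).bind fun k => if k ≤ c then some (c - k + 1) else none :=
    Primrec.option_bind (Primrec.snd.comp (Primrec.snd.comp Primrec.fst))
      (Primrec.option_bind hget hle).to₂
  exact Primrec.sumCasesOn (Primrec.fst.comp Primrec.snd) hvar hfun

theorem primrec_countTerms : Primrec₂ countTerms := by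
  have hstep : Primrec₂ fun (p : List ℕ × Word) (q : (ℕ ⊕ ℕ) × Option ℕ) =>
      countStep p.1 q.1 q.2 :=
    primrec_countStep.comp (Primrec.pair (Primrec.fst.comp Primrec.fst) Primrec.snd)
  exact Primrec.list_foldr Primrec.snd (Primrec.const (some 0)) hstep

theorem primrec_factors : Primrec factors := by
  have hr : Primrec fun w : Word => List.range (w.length + 1) :=
    Primrec.list_range.comp (Primrec.succ.comp Primrec.list_length)
  have hf : Primrec₂ fun (q : Word × ℕ) (j : ℕ) => (q.1.drop q.2).take j :=
    Primrec.list_take.comp Primrec.snd (Primrec.list_drop.comp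
      (Primrec.snd.comp Primrec.fst) (Primrec.fst.comp Primrec.fst))
  exact Primrec.list_flatMap hr (Primrec.list_map (hr.comp Primrec.fst) hf)

theorem primrec_termFactors : Primrec₂ termFactors := by
  have hp : Primrec₂ fun (p : List ℕ × Word) (u : Word) =>
      if countTerms p.1 u = some 1 then some u else none :=
    (Primrec.ite (Primrec.eq.comp (primrec_countTerms.comp (Primrec.fst.comp Primrec.fst)
      Primrec.snd) (Primrec.const _)) (Primrec.option_some.comp Primrec.snd)
      (Primrec.const none)).to₂
  refine (Primrec.listFilterMap (primrec_factors.comp Primrec.snd) hp).of_eq fun p => ?_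
  simp [termFactors, ← List.filterMap_eq_filter, Option.guard]

theorem primrec_wordVars : Primrec wordVars :=
  Primrec.listFilterMap Primrec.id (Primrec.sumCasesOn Primrec.snd
    (Primrec.option_some.comp Primrec.snd).to₂ (Primrec.const none).to₂).to₂

theorem primrec_assignments : Primrec₂ assignments := by
  have hcons : Primrec₂ fun (r : ((List Word × List ℕ) × ℕ × List (List (ℕ × Word))) ×
      List (ℕ × Word)) (u : Word) => (r.1.2.1, u) :: r.2 :=
    Primrec.list_cons.comp (Primrec.pair (Primrec.fst.comp (Primrec.snd.comp
      (Primrec.fst.comp Primrec.fst))) Primrec.snd) (Primrec.snd.comp Primrec.fst)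
  have hstep : Primrec₂ fun (p : List Word × List ℕ) (q : ℕ × List (List (ℕ × Word))) =>
      q.2.flatMap fun θ => p.1.map fun u => (q.1, u) :: θ :=
    Primrec.list_flatMap (Primrec.snd.comp Primrec.snd)
      (Primrec.list_map (Primrec.fst.comp (Primrec.fst.comp Primrec.fst)) hcons).to₂
  exact Primrec.list_foldr Primrec.snd (Primrec.const [[]]) hstep

theorem primrec_substWord : Primrec₂ substWord := by
  have hvar : Primrec₂ fun (q : (List (ℕ × Word) × Word) × (ℕ ⊕ ℕ)) (x : ℕ) =>
      (q.1.1.lookup x).getD [Sum.inl x] :=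
    Primrec.option_getD.comp (Primrec.listLookup.comp Primrec.snd
      (Primrec.fst.comp (Primrec.fst.comp Primrec.fst)))
      (Primrec.list_cons.comp (Primrec.sumInl.comp Primrec.snd) (Primrec.const []))
  have hfun : Primrec₂ fun (_ : (List (ℕ × Word) × Word) × (ℕ ⊕ ℕ)) (i : ℕ) =>
      ([Sum.inr i] : Word) :=
    Primrec.list_cons.comp (Primrec.sumInr.comp Primrec.snd) (Primrec.const [])
  exact Primrec.list_flatMap Primrec.snd (Primrec.sumCasesOn Primrec.snd hvar hfun)

theorem primrec_replacements :
    Primrec fun p : Word × Word × Word => replacements p.1 p.2.1 p.2.2 := by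
  refine Primrec.list_flatMap (Primrec.list_range.comp (Primrec.succ.comp
    (Primrec.list_length.comp Primrec.fst))) ?_
  have hw : Primrec fun q : (Word × Word × Word) × ℕ => q.1.1 := Primrec.fst.comp Primrec.fst
  have hu : Primrec fun q : (Word × Word × Word) × ℕ => q.1.2.1 :=
    Primrec.fst.comp (Primrec.snd.comp Primrec.fst)
  have hu' : Primrec fun q : (Word × Word × Word) × ℕ => q.1.2.2 :=
    Primrec.snd.comp (Primrec.snd.comp Primrec.fst)
  have hnew : Primrec fun q : (Word × Word × Word) × ℕ =>
      [q.1.1.take q.2 ++ q.1.2.2 ++ q.1.1.drop (q.2 + q.1.2.1.length)] :=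
    Primrec.list_cons.comp (Primrec.list_append.comp (Primrec.list_append.comp
      (Primrec.list_take.comp Primrec.snd hw) hu') (Primrec.list_drop.comp
      (Primrec.nat_add.comp Primrec.snd (Primrec.list_length.comp hu)) hw)) (Primrec.const [])
  exact Primrec.ite (Primrec.eq.comp (Primrec.list_take.comp (Primrec.list_length.comp hu)
    (Primrec.list_drop.comp Primrec.snd hw)) hu) hnew (Primrec.const [])

theorem primrec_reducts :
    Primrec fun p : (List ℕ × List (Word × Word)) × Word => reducts p.1.1 p.1.2 p.2 := by
  refine Primrec.list_flatMap (Primrec.snd.comp Primrec.fst) ?_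
  have hrep : Primrec₂ fun (q : ((List ℕ × List (Word × Word)) × Word) × Word × Word)
      (θ : List (ℕ × Word)) => replacements q.1.2 (substWord θ q.2.1) (substWord θ q.2.2) :=
    primrec_replacements.comp (Primrec.pair
      (Primrec.snd.comp (Primrec.fst.comp Primrec.fst))
      (Primrec.pair
        (primrec_substWord.comp Primrec.snd (Primrec.fst.comp (Primrec.snd.comp Primrec.fst)))
        (primrec_substWord.comp Primrec.snd (Primrec.snd.comp (Primrec.snd.comp Primrec.fst)))))
  exact Primrec.list_flatMap (primrec_assignments.comp (primrec_termFactors.comp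
    (Primrec.fst.comp (Primrec.fst.comp Primrec.fst)) (Primrec.snd.comp Primrec.fst))
    (primrec_wordVars.comp (Primrec.fst.comp Primrec.snd))) hrep

end Primrec

/-! ### Breadth-first search in the reduction tree -/

/-- The words obtained from those in `L` by exactly `k` rewrite steps. -/
def reductLevel (σ : List ℕ) (rules : List (Word × Word)) (L : List Word) (k : ℕ) : List Word :=
  (fun L => L.flatMap (reducts σ rules))^[k] L

/-- The stopping condition of `smallTermDecider`: no word is left, or a short one is found. -/
def searchStops (σ : List ℕ) (rules : List (Word × Word)) (w : Word) (n k : ℕ) : Prop :=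
  reductLevel σ rules [w] k = [] ∨ ∃ u ∈ reductLevel σ rules [w] k, u.length ≤ n

instance (σ : List ℕ) (rules : List (Word × Word)) (w : Word) (n k : ℕ) :
    Decidable (searchStops σ rules w n k) :=
  inferInstanceAs (Decidable (_ ∨ _))

/-- Breadth-first search for a reduct of size at most `n`. -/
def smallTermDecider (p : List ℕ × List (Word × Word) × Word × ℕ) : Part Bool :=
  (Nat.rfind fun k => Part.some (decide (searchStops p.1 p.2.1 p.2.2.1 p.2.2.2 k))).map fun k =>
    decide (¬ reductLevel p.1 p.2.1 [p.2.2.1] k = [])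

theorem primrec_reductLevel {α : Type*} [Primcodable α] {fσ : α → List ℕ}
    {fR : α → List (Word × Word)} {fL : α → List Word} {fk : α → ℕ} (hσ : Primrec fσ)
    (hR : Primrec fR) (hL : Primrec fL) (hk : Primrec fk) :
    Primrec fun a => reductLevel (fσ a) (fR a) (fL a) (fk a) := by
  have hred : Primrec₂ fun (r : α × List Word) (w : Word) => reducts (fσ r.1) (fR r.1) w :=
    primrec_reducts.comp (((hσ.comp (Primrec.fst.comp Primrec.fst)).pair
      (hR.comp (Primrec.fst.comp Primrec.fst))).pair Primrec.snd)
  exact Primrec.nat_iterate hk hL (Primrec.list_flatMap Primrec.snd hred).to₂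

theorem partrec_smallTermDecider : Partrec smallTermDecider := by
  have hlevel : Primrec fun q : (List ℕ × List (Word × Word) × Word × ℕ) × ℕ =>
      reductLevel q.1.1 q.1.2.1 [q.1.2.2.1] q.2 :=
    primrec_reductLevel (Primrec.fst.comp Primrec.fst)
      (Primrec.fst.comp (Primrec.snd.comp Primrec.fst))
      (Primrec.list_cons.comp (Primrec.fst.comp
        (Primrec.snd.comp (Primrec.snd.comp Primrec.fst))) (Primrec.const [])) Primrec.snd
  have hnil : PrimrecPred fun q : (List ℕ × List (Word × Word) × Word × ℕ) × ℕ =>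
      reductLevel q.1.1 q.1.2.1 [q.1.2.2.1] q.2 = [] :=
    Primrec.eq.comp hlevel (Primrec.const [])
  have hshort : PrimrecRel fun (u : Word) (n : ℕ) => u.length ≤ n :=
    Primrec.nat_le.comp (Primrec.list_length.comp Primrec.fst) Primrec.snd
  have hhalt : PrimrecPred fun q : (List ℕ × List (Word × Word) × Word × ℕ) × ℕ =>
      searchStops q.1.1 q.1.2.1 q.1.2.2.1 q.1.2.2.2 q.2 :=
    hnil.or (hshort.exists_mem_list.comp hlevel
      (Primrec.snd.comp (Primrec.snd.comp (Primrec.snd.comp Primrec.fst))))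
  exact (Partrec.rfind hhalt.decide.to_comp.partrec.to₂).map hnil.not.decide.to_comp.to₂

/-! ### Correctness and termination of the search -/

section Levels

variable {σ : List ℕ}

theorem reductLevel_succ (rules : List (Word × Word)) (L : List Word) (k : ℕ) :
    reductLevel σ rules L (k + 1) = reductLevel σ rules (L.flatMap (reducts σ rules)) k := rfl

theorem reductLevel_succ' (rules : List (Word × Word)) (L : List Word) (k : ℕ) :
    reductLevel σ rules L (k + 1) = (reductLevel σ rules L k).flatMap (reducts σ rules) :=
  Function.iterate_succ_apply' _ _ _

theorem reductLevel_eq_nil_of_le {rules : List (Word × Word)} {L : List Word} {k m : ℕ}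
    (hkm : k ≤ m) (h : reductLevel σ rules L k = []) : reductLevel σ rules L m = [] := by
  induction m, hkm using Nat.le_induction with
  | base => exact h
  | succ m _ ih => rw [reductLevel_succ', ih, List.flatMap_nil]

theorem mem_reductLevel {rules : List (Word × Word)} {L : List Word} {k : ℕ} {u : Word} :
    u ∈ reductLevel σ rules L k ↔ ∃ w ∈ L, u ∈ reductLevel σ rules [w] k := by
  induction k generalizing L u with
  | zero => simp [reductLevel]
  | succ k ih =>
    simp only [reductLevel_succ', List.mem_flatMap]
    constructor
    · rintro ⟨v, hv, hu⟩
      obtain ⟨w, hw, hv⟩ := ih.1 hv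
      exact ⟨w, hw, v, hv, hu⟩
    · rintro ⟨w, hw, v, hv, hu⟩
      exact ⟨v, ih.2 ⟨w, hw, hv⟩, hu⟩

namespace TRS

variable {R : TRS (sig σ)}

theorem exists_reaches_of_mem_reductLevel {s : Tm (sig σ)} {k : ℕ} {u : Word}
    (h : u ∈ reductLevel σ R.encode [encodeTerm s] k) : ∃ t, R.Reaches s t ∧ encodeTerm t = u := by
  induction k generalizing u with
  | zero =>
    obtain rfl : u = encodeTerm s := by simpa [reductLevel] using h
    exact ⟨s, .refl, rfl⟩
  | succ k ih =>
    rw [reductLevel_succ', List.mem_flatMap] at h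
    obtain ⟨v, hv, hu⟩ := h
    obtain ⟨t, ht, rfl⟩ := ih hv
    obtain ⟨t', ht', rfl⟩ := mem_reducts_encode.1 hu
    exact ⟨t', ht.tail ht', rfl⟩

theorem Reaches.exists_mem_reductLevel {s t : Tm (sig σ)} (h : R.Reaches s t) :
    ∃ k, encodeTerm t ∈ reductLevel σ R.encode [encodeTerm s] k := by
  induction h with
  | refl => exact ⟨0, by simp [reductLevel]⟩
  | tail _ h ih =>
    obtain ⟨k, hk⟩ := ih
    refine ⟨k + 1, ?_⟩
    rw [reductLevel_succ', List.mem_flatMap]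
    exact ⟨_, hk, mem_reducts_encode.2 ⟨_, h, rfl⟩⟩

theorem Terminating.wellFounded (hR : R.Terminating) :
    WellFounded fun t s : Tm (sig σ) => R.Step s t := by
  rw [wellFounded_iff_isEmpty_descending_chain]
  exact ⟨fun f => hR ⟨f.1, f.2⟩⟩

/-- Well-founded induction along reduction: each of the finitely many reducts has an empty level,
and a common bound plus one works for `s`. -/
theorem Terminating.exists_reductLevel_eq_nil (hR : R.Terminating) (s : Tm (sig σ)) :
    ∃ k, reductLevel σ R.encode [encodeTerm s] k = [] := by
  induction s using hR.wellFounded.induction with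
  | _ s ih =>
    have hlist : ∀ L : List Word, (∀ u ∈ L, ∃ k, reductLevel σ R.encode [u] k = []) →
        ∃ k, reductLevel σ R.encode L k = [] := by
      intro L hL
      choose! K hK using hL
      -- The sum serves as an upper bound of all the individual depths.
      refine ⟨(L.map K).sum, List.eq_nil_iff_forall_not_mem.2 fun v hv => ?_⟩
      obtain ⟨w, hw, hv⟩ := mem_reductLevel.1 hv
      rw [reductLevel_eq_nil_of_le
        (List.single_le_sum (by simp) _ (List.mem_map_of_mem hw)) (hK w hw)] at hv
      simp at hv
    obtain ⟨k, hk⟩ := hlist (reducts σ R.encode (encodeTerm s)) fun u hu => by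
      obtain ⟨t, ht, rfl⟩ := mem_reducts_encode.1 hu
      exact ih t ht
    exact ⟨k + 1, by simpa [reductLevel_succ] using hk⟩

theorem Terminating.finite_reaches (hR : R.Terminating) (s : Tm (sig σ)) :
    {t | R.Reaches s t}.Finite := by
  obtain ⟨K, hK⟩ := hR.exists_reductLevel_eq_nil s
  refine Set.Finite.of_finite_image (f := encodeTerm) (Set.Finite.subset
    (((List.range K).flatMap (reductLevel σ R.encode [encodeTerm s])).finite_toSet) ?_)
    encodeTerm_injective.injOn
  rintro _ ⟨t, ht, rfl⟩
  obtain ⟨k, hk⟩ := Reaches.exists_mem_reductLevel ht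
  refine List.mem_flatMap.2 ⟨k, List.mem_range.2 (lt_of_not_ge fun h => ?_), hk⟩
  rw [reductLevel_eq_nil_of_le h hK] at hk
  simp at hk

/-- An empty level guarantees halting. At the stopping level the answer is read off from
nonemptiness, since a nonempty level can only stop the search by containing a short word. -/
theorem Terminating.smallTermDecider_spec (hR : R.Terminating) (s : Tm (sig σ)) (n : ℕ) :
    ∃ b ∈ smallTermDecider (σ, R.encode, encodeTerm s, n),
      b = true ↔ R.SmallTermReachable s n := by
  obtain ⟨K, hK⟩ := hR.exists_reductLevel_eq_nil s
  obtain ⟨k, hk, -⟩ := Nat.rfind_min'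
    (p := fun k => decide (searchStops σ R.encode (encodeTerm s) n k)) (m := K)
    (decide_eq_true (Or.inl hK))
  refine ⟨_, Part.mem_map _ hk, ?_⟩
  rw [decide_eq_true_iff]
  obtain ⟨h₁, h₂⟩ := Nat.mem_rfind.1 hk
  have h₁ : searchStops σ R.encode (encodeTerm s) n k := by simpa using h₁
  constructor
  · intro hne
    obtain ⟨u, hu, hun⟩ := h₁.resolve_left hne
    obtain ⟨t, ht, rfl⟩ := exists_reaches_of_mem_reductLevel hu
    exact ⟨t, ht, by rwa [← length_encodeTerm]⟩
  · rintro ⟨t, ht, htn⟩ hnil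
    obtain ⟨m, hm⟩ := Reaches.exists_mem_reductLevel ht
    -- A small reduct would have to occur before the empty level `k`, where the search would have
    -- stopped already.
    have hmk : m < k := lt_of_not_ge fun h => by
      rw [reductLevel_eq_nil_of_le h hnil] at hm
      simp at hm
    have : ¬ searchStops σ R.encode (encodeTerm s) n m := by simpa using h₂ hmk
    exact this (Or.inr ⟨_, hm, by rwa [length_encodeTerm]⟩)

theorem Terminating.smallTermReachabilityDecidable (hR : R.Terminating) :
    R.SmallTermReachabilityDecidable := by
  -- The predicate ranges over all words, while the search is known to halt only on terms; other
  -- words are rejected beforehand.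
  let d : Word × ℕ →. Bool := fun p =>
    bif decide (countTerms σ p.1 = some 1) then smallTermDecider (σ, R.encode, p)
    else Part.some false
  have hd : Partrec d :=
    Partrec.cond (PrimrecPred.decide (Primrec.eq.comp (primrec_countTerms.comp (Primrec.const σ)
      Primrec.fst) (Primrec.const _))).to_comp
      (partrec_smallTermDecider.comp (Primrec.pair (Primrec.const σ)
        (Primrec.pair (Primrec.const R.encode) Primrec.id)).to_comp)
      (Computable.const false).partrec
  have hspec : ∀ p : Word × ℕ, ∃ b ∈ d p,
      b = true ↔ ∃ s, encodeTerm s = p.1 ∧ R.SmallTermReachable s p.2 := by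
    rintro ⟨w, n⟩
    by_cases hw : countTerms σ w = some 1
    · obtain ⟨s, rfl⟩ := countTerms_eq_one_iff.1 hw
      obtain ⟨b, hb, h⟩ := hR.smallTermDecider_spec s n
      refine ⟨b, by simpa [d, hw] using hb, h.trans ⟨fun h => ⟨s, rfl, h⟩, ?_⟩⟩
      rintro ⟨s', hs', h⟩
      rwa [← encodeTerm_injective hs']
    · refine ⟨false, by simp [d, hw], iff_of_false (by simp) ?_⟩
      rintro ⟨s, rfl, -⟩
      exact hw (countTerms_encodeTerm s)
  choose b hb hbs using hspec
  refine ComputablePred.computable_iff.2 ⟨b, hd.of_eq fun p => Part.eq_some_iff.2 (hb p), ?_⟩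
  funext p
  exact propext (hbs p).symm

end TRS

end Levels

/-! ### Function symbols applied to lists of arguments -/

section App

open FirstOrder.Language

variable {σ : List ℕ}

/-- The term with the `i`-th function symbol at the root and the list `ts` of arguments. -/
def app (i : ℕ) (ts : List (Tm (sig σ))) (h : σ[i]? = some ts.length) : Tm (sig σ) :=
  Term.func (L := sig σ) (l := ts.length)
    ⟨⟨i, (List.getElem?_eq_some_iff.1 h).1⟩, (List.getElem?_eq_some_iff.1 h).2⟩ ts.get

theorem app_eq_func {k : ℕ} (f : (sig σ).Functions k) (g : Fin k → Tm (sig σ)) {i : ℕ}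
    {ts : List (Tm (sig σ))} (hi : (f.1 : ℕ) = i) (hts : List.ofFn g = ts)
    (h : σ[i]? = some ts.length) : app i ts h = Term.func f g := by
  obtain rfl : ts.length = k := by simp [← hts]
  obtain rfl : ts.get = g := List.ofFn_injective (by rw [List.ofFn_get, hts])
  subst hi
  rfl

theorem exists_func_eq_app {i : ℕ} {ts : List (Tm (sig σ))} (h : σ[i]? = some ts.length) :
    ∃ (f : (sig σ).Functions ts.length) (g : Fin ts.length → Tm (sig σ)),
      (f.1 : ℕ) = i ∧ List.ofFn g = ts ∧ app i ts h = Term.func f g :=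
  ⟨_, _, rfl, List.ofFn_get ts, rfl⟩

theorem app_induction {P : Tm (sig σ) → Prop} (hvar : ∀ x, P (Term.var x))
    (happ : ∀ i ts h, (∀ t ∈ ts, P t) → P (app i ts h)) (t : Tm (sig σ)) : P t := by
  induction t with
  | var x => exact hvar x
  | func f g ih =>
    have h : σ[(f.1 : ℕ)]? = some (List.ofFn g).length := by
      rw [List.length_ofFn]
      exact List.getElem?_eq_some_iff.2 ⟨f.1.2, f.2⟩
    rw [← app_eq_func f g rfl rfl h]
    refine happ _ _ _ fun t ht => ?_
    obtain ⟨j, rfl⟩ := (List.mem_ofFn' _ _).1 ht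
    exact ih j

theorem encodeTerm_app (i : ℕ) (ts : List (Tm (sig σ))) (h : σ[i]? = some ts.length) :
    encodeTerm (app i ts h) = Sum.inr i :: ts.flatMap encodeTerm := by
  obtain ⟨f, g, hf, hg, hfg⟩ := exists_func_eq_app h
  rw [hfg, encodeTerm_func, hf, hg]

-- As a `simp` lemma this turns an equation between machine terms into equations between their
-- parts, so that matching against rules is done by `simp`.
@[simp]
theorem app_inj {i j : ℕ} {ts us : List (Tm (sig σ))} {h : σ[i]? = some ts.length}
    {h' : σ[j]? = some us.length} : app i ts h = app j us h' ↔ i = j ∧ ts = us := by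
  constructor
  · intro heq
    have hw := congrArg encodeTerm heq
    simp only [encodeTerm_app, List.cons.injEq, Sum.inr.injEq] at hw
    obtain ⟨rfl, hw⟩ := hw
    exact ⟨rfl, (flatMap_prefix_unique (w := []) (w' := [])
      (fun _ _ _ _ _ => encodeTerm_prefix_unique) (Option.some.inj (h.symm.trans h'))
      (by rw [hw])).1⟩
  · rintro ⟨rfl, rfl⟩
    rfl

@[simp]
theorem app_ne_var {i x : ℕ} {ts : List (Tm (sig σ))} {h : σ[i]? = some ts.length} :
    app i ts h ≠ Term.var x := by
  simp [app]

@[simp]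
theorem subst_app (i : ℕ) (ts : List (Tm (sig σ))) (h : σ[i]? = some ts.length)
    (θ : ℕ → Tm (sig σ)) :
    (app i ts h).subst θ = app i (ts.map fun t => t.subst θ) (by simpa using h) := by
  obtain ⟨f, g, hf, hg, hfg⟩ := exists_func_eq_app h
  rw [hfg, Term.subst]
  have hm : List.ofFn (fun j => (g j).subst θ) = ts.map fun t => t.subst θ := by
    conv_rhs => rw [← hg, List.map_ofFn]
    rfl
  exact (app_eq_func f _ hf hm _).symm

@[simp]
theorem mem_varFinset_app {i x : ℕ} {ts : List (Tm (sig σ))} {h : σ[i]? = some ts.length} :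
    x ∈ (app i ts h).varFinset ↔ ∃ t ∈ ts, x ∈ t.varFinset := by
  rw [← inl_mem_encodeTerm, encodeTerm_app]
  simp [inl_mem_encodeTerm]

namespace TRS

variable {R : TRS (sig σ)}

theorem Step.app {i : ℕ} {p q : List (Tm (sig σ))} {u u' : Tm (sig σ)} (hu : R.Step u u')
    (h : σ[i]? = some (p ++ u :: q).length) (h' : σ[i]? = some (p ++ u' :: q).length) :
    R.Step (app i (p ++ u :: q) h) (app i (p ++ u' :: q) h') := by
  obtain ⟨f, g, hf, hg, hfg⟩ := exists_func_eq_app h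
  obtain ⟨j, hju, hj⟩ := List.exists_update_of_ofFn_eq hg
  rw [hfg, app_eq_func f _ hf (hj u') h']
  exact Step.arg f g j u' (hju ▸ hu)

theorem Step.app_cases {i : ℕ} {ts : List (Tm (sig σ))} {h : σ[i]? = some ts.length}
    {t' : Tm (sig σ)} (hs : R.Step (TermRewriting.app i ts h) t') :
    (∃ ρ ∈ R.rules, ∃ θ : ℕ → Tm (sig σ),
      TermRewriting.app i ts h = ρ.1.subst θ ∧ t' = ρ.2.subst θ) ∨
    ∃ p u u' q h', ts = p ++ u :: q ∧ R.Step u u' ∧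
      t' = TermRewriting.app i (p ++ u' :: q) h' := by
  generalize hs' : TermRewriting.app i ts h = s at hs
  cases hs with
  | rule ρ hρ θ => exact .inl ⟨ρ, hρ, θ, rfl, rfl⟩
  | arg f g j u hu =>
    obtain ⟨p, q, hpq⟩ := List.exists_ofFn_update g j
    have hg := hpq (g j)
    rw [Function.update_eq_self] at hg
    have hf : σ[(f.1 : ℕ)]? = some (List.ofFn g).length := by
      rw [List.length_ofFn]
      exact List.getElem?_eq_some_iff.2 ⟨f.1.2, f.2⟩
    rw [← app_eq_func f g rfl rfl hf, app_inj] at hs'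
    obtain ⟨rfl, rfl⟩ := hs'
    have h' : σ[(f.1 : ℕ)]? = some (p ++ u :: q).length := by rw [h, hg]; simp
    exact .inr ⟨p, g j, u, q, h', hg, hu, (app_eq_func f _ rfl (hpq u) h').symm⟩

theorem not_step_var (x : ℕ) (t : Tm (sig σ)) : ¬ R.Step (Term.var x) t := by
  intro h
  generalize hs : (Term.var x : Tm (sig σ)) = s at h
  cases h with
  | rule ρ hρ θ =>
    cases hl : ρ.1 with
    | var y => exact R.lhs_ne_var ρ hρ y hl
    | func f g => rw [hl] at hs; simp at hs
  | arg f g j u hu => simp at hs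

/-- The arguments are rewritten from left to right; `p` collects those already finished. -/
theorem reaches_app_of_forall₂ {i : ℕ} {ts us : List (Tm (sig σ))}
    (hts : List.Forall₂ R.Reaches ts us) (p : List (Tm (sig σ)))
    (h : σ[i]? = some (p ++ ts).length) (h' : σ[i]? = some (p ++ us).length) :
    R.Reaches (TermRewriting.app i (p ++ ts) h) (TermRewriting.app i (p ++ us) h') := by
  induction hts generalizing p with
  | nil => exact .refl
  | @cons t u ts us htu _ ih =>
    have h₁ : σ[i]? = some (p ++ u :: ts).length := by simpa using h
    have hhead : ∀ v h₂, R.Reaches t v →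
        R.Reaches (TermRewriting.app i (p ++ t :: ts) h)
          (TermRewriting.app i (p ++ v :: ts) h₂) := by
      intro v h₂ hv
      induction hv with
      | refl => exact .refl
      | tail _ hs ih => exact (ih (by simpa using h)).tail (hs.app _ _)
    have htail := ih (p ++ [u]) (by simpa using h₁) (by simpa using h')
    simp only [List.append_assoc, List.cons_append, List.nil_append] at htail
    exact (hhead u h₁ htu).trans htail

end TRS

end App

/-! ### The confluent system with undecidable small term reachability -/

namespace Machine

open FirstOrder.Language Turing.ToPartrec

/-- Arities: `run`, `ret`, `done`; zero, successor; nil, cons; the constructors of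
`Turing.ToPartrec.Code`; the constructors of `Turing.ToPartrec.Cont`. -/
def arities : List ℕ := [3, 2, 0, 0, 1, 0, 2, 0, 0, 0, 2, 2, 2, 1, 0, 3, 2, 2, 2]

abbrev T : Type := Tm (sig arities)

abbrev run (c k v : T) : T := app 0 [c, k, v] (by unfold arities; rfl)
abbrev ret (k v : T) : T := app 1 [k, v] (by unfold arities; rfl)
abbrev done : T := app 2 [] (by unfold arities; rfl)
abbrev zero : T := app 3 [] (by unfold arities; rfl)
abbrev succ (n : T) : T := app 4 [n] (by unfold arities; rfl)
abbrev nil : T := app 5 [] (by unfold arities; rfl)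
abbrev cons (n v : T) : T := app 6 [n, v] (by unfold arities; rfl)
abbrev codeZero : T := app 7 [] (by unfold arities; rfl)
abbrev codeSucc : T := app 8 [] (by unfold arities; rfl)
abbrev codeTail : T := app 9 [] (by unfold arities; rfl)
abbrev codeCons (f g : T) : T := app 10 [f, g] (by unfold arities; rfl)
abbrev codeComp (f g : T) : T := app 11 [f, g] (by unfold arities; rfl)
abbrev codeCase (f g : T) : T := app 12 [f, g] (by unfold arities; rfl)
abbrev codeFix (f : T) : T := app 13 [f] (by unfold arities; rfl)
abbrev contHalt : T := app 14 [] (by unfold arities; rfl)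
abbrev contCons₁ (f v k : T) : T := app 15 [f, v, k] (by unfold arities; rfl)
abbrev contCons₂ (v k : T) : T := app 16 [v, k] (by unfold arities; rfl)
abbrev contComp (f k : T) : T := app 17 [f, k] (by unfold arities; rfl)
abbrev contFix (f k : T) : T := app 18 [f, k] (by unfold arities; rfl)

/-- The normal form that every term with root `run`, `ret` or `done` may be rewritten to. -/
abbrev stuck : T := succ zero

abbrev X (i : ℕ) : T := Term.var i

/-- The rules of an abstract machine that evaluates a `Turing.ToPartrec.Code`. -/
def rules : List (T × T) :=
  [(run codeZero (X 0) (X 1), ret (X 0) (cons zero (X 1))),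
   (run codeSucc (X 0) nil, ret (X 0) (cons (succ zero) nil)),
   (run codeSucc (X 0) (cons (X 1) (X 2)), ret (X 0) (cons (succ (X 1)) nil)),
   (run codeTail (X 0) nil, ret (X 0) nil),
   (run codeTail (X 0) (cons (X 1) (X 2)), ret (X 0) (X 2)),
   (run (codeCons (X 0) (X 1)) (X 2) (X 3), run (X 0) (contCons₁ (X 1) (X 3) (X 2)) (X 3)),
   (run (codeComp (X 0) (X 1)) (X 2) (X 3), run (X 1) (contComp (X 0) (X 2)) (X 3)),
   (run (codeCase (X 0) (X 1)) (X 2) nil, run (X 0) (X 2) nil),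
   (run (codeCase (X 0) (X 1)) (X 2) (cons zero (X 3)), run (X 0) (X 2) (X 3)),
   (run (codeCase (X 0) (X 1)) (X 2) (cons (succ (X 3)) (X 4)),
     run (X 1) (X 2) (cons (X 3) (X 4))),
   (run (codeFix (X 0)) (X 1) (X 2), run (X 0) (contFix (X 0) (X 1)) (X 2)),
   (ret contHalt (X 0), done),
   (ret (contCons₁ (X 0) (X 1) (X 2)) (X 3), run (X 0) (contCons₂ (X 3) (X 2)) (X 1)),
   (ret (contCons₂ nil (X 0)) (X 1), ret (X 0) (cons zero (X 1))),
   (ret (contCons₂ (cons (X 0) (X 1)) (X 2)) (X 3), ret (X 2) (cons (X 0) (X 3))),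
   (ret (contComp (X 0) (X 1)) (X 2), run (X 0) (X 1) (X 2)),
   (ret (contFix (X 0) (X 1)) nil, ret (X 1) nil),
   (ret (contFix (X 0) (X 1)) (cons zero (X 2)), ret (X 1) (X 2)),
   (ret (contFix (X 0) (X 1)) (cons (succ (X 2)) (X 3)), run (X 0) (contFix (X 0) (X 1)) (X 3)),
   (run (X 0) (X 1) (X 2), stuck),
   (ret (X 0) (X 1), stuck),
   (done, stuck)]

/-- The system with these rules. It is confluent since every term with root `run`, `ret` or `done`
may be rewritten to the ground normal form `stuck`, and no term with another root is a redex. -/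
def system : TRS (sig arities) where
  rules := rules
  lhs_ne_var := by simp [rules]
  vars_subset := by
    simp only [rules, List.forall_mem_cons, Finset.subset_iff]
    simp
    grind

/-- A rule is picked by its position in `rules`, and `θ` lists the values of `X 0`, `X 1`, and so
on; the default `zero` is for variables that the rule does not contain. -/
theorem step_of_getElem (i : ℕ) {ρ : T × T} (h : rules[i]? = some ρ) (θ : List T) {t t' : T}
    (ht : ρ.1.subst (fun x => θ.getD x zero) = t) (ht' : ρ.2.subst (fun x => θ.getD x zero) = t') :
    system.Step t t' := by
  subst ht ht'
  exact TRS.Step.rule ρ (List.mem_of_getElem? h) _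

def encNat : ℕ → T
  | 0 => zero
  | n + 1 => succ (encNat n)

def encList : List ℕ → T
  | [] => nil
  | n :: v => cons (encNat n) (encList v)

def encCode : Code → T
  | .zero' => codeZero
  | .succ => codeSucc
  | .tail => codeTail
  | .cons f g => codeCons (encCode f) (encCode g)
  | .comp f g => codeComp (encCode f) (encCode g)
  | .case f g => codeCase (encCode f) (encCode g)
  | .fix f => codeFix (encCode f)

def encCont : Cont → T
  | .halt => contHalt
  | .cons₁ f v k => contCons₁ (encCode f) (encList v) (encCont k)
  | .cons₂ v k => contCons₂ (encList v) (encCont k)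
  | .comp f k => contComp (encCode f) (encCont k)
  | .fix f k => contFix (encCode f) (encCont k)

/-- The output is dropped: only halting matters, and `done` has to have size 1. -/
def encCfg : Cfg → T
  | .halt _ => done
  | .ret k v => ret (encCont k) (encList v)

/-- `stepNormal` descends through the code in one go, whereas the machine takes one step per
constructor; hence the induction on `c` with varying continuation. -/
theorem reaches_stepNormal (c : Code) (k : Cont) (v : List ℕ) :
    system.Reaches (run (encCode c) (encCont k) (encList v)) (encCfg (stepNormal c k v)) := by
  induction c generalizing k v with
  | zero' =>
    exact .single (step_of_getElem 0 rfl [encCont k, encList v] (by simp [encCode])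
      (by simp [encCfg, stepNormal, encList, encNat]))
  | succ =>
    cases v with
    | nil =>
      exact .single (step_of_getElem 1 rfl [encCont k] (by simp [encCode, encList])
        (by simp [encCfg, stepNormal, encList, encNat]))
    | cons n v =>
      exact .single (step_of_getElem 2 rfl [encCont k, encNat n, encList v]
        (by simp [encCode, encList]) (by simp [encCfg, stepNormal, encList, encNat]))
  | tail =>
    cases v with
    | nil =>
      exact .single (step_of_getElem 3 rfl [encCont k] (by simp [encCode, encList])
        (by simp [encCfg, stepNormal, encList]))
    | cons n v =>
      exact .single (step_of_getElem 4 rfl [encCont k, encNat n, encList v]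
        (by simp [encCode, encList]) (by simp [encCfg, stepNormal]))
  | cons f g ihf _ =>
    exact .head (step_of_getElem 5 rfl [encCode f, encCode g, encCont k, encList v]
      (by simp [encCode]) (by simp [encCont])) (ihf (.cons₁ g v k) v)
  | comp f g _ ihg =>
    exact .head (step_of_getElem 6 rfl [encCode f, encCode g, encCont k, encList v]
      (by simp [encCode]) (by simp [encCont])) (ihg (.comp f k) v)
  | case f g ihf ihg =>
    rcases v with _ | ⟨_ | n, v⟩
    · exact .head (step_of_getElem 7 rfl [encCode f, encCode g, encCont k]
        (by simp [encCode, encList]) (by simp [encList])) (ihf k [])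
    · exact .head (step_of_getElem 8 rfl [encCode f, encCode g, encCont k, encList v]
        (by simp [encCode, encList, encNat]) (by simp)) (ihf k v)
    · exact .head (step_of_getElem 9 rfl [encCode f, encCode g, encCont k, encNat n, encList v]
        (by simp [encCode, encList, encNat]) (by simp [encList])) (ihg k (n :: v))
  | fix f ih =>
    exact .head (step_of_getElem 10 rfl [encCode f, encCont k, encList v]
      (by simp [encCode]) (by simp [encCont])) (ih (.fix f k) v)

theorem reaches_stepRet (k : Cont) (v : List ℕ) :
    system.Reaches (ret (encCont k) (encList v)) (encCfg (stepRet k v)) := by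
  induction k generalizing v with
  | halt =>
    exact .single (step_of_getElem 11 rfl [encList v] (by simp [encCont])
      (by simp [encCfg, stepRet]))
  | cons₁ f as k _ =>
    exact .head (step_of_getElem 12 rfl [encCode f, encList as, encCont k, encList v]
      (by simp [encCont]) (by simp [encCont])) (reaches_stepNormal f (.cons₂ v k) as)
  | cons₂ ns k ih =>
    cases ns with
    | nil =>
      exact .head (step_of_getElem 13 rfl [encCont k, encList v] (by simp [encCont, encList])
        (by simp [encList, encNat])) (ih (0 :: v))
    | cons n ns =>
      exact .head (step_of_getElem 14 rfl [encNat n, encList ns, encCont k, encList v]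
        (by simp [encCont, encList]) (by simp [encList])) (ih (n :: v))
  | comp f k _ =>
    exact .head (step_of_getElem 15 rfl [encCode f, encCont k, encList v]
      (by simp [encCont]) (by simp)) (reaches_stepNormal f k v)
  | fix f k ih =>
    rcases v with _ | ⟨_ | n, v⟩
    · exact .head (step_of_getElem 16 rfl [encCode f, encCont k]
        (by simp [encCont, encList]) (by simp [encList])) (ih [])
    · exact .head (step_of_getElem 17 rfl [encCode f, encCont k, encList v]
        (by simp [encCont, encList, encNat]) (by simp)) (ih v)
    · exact .head (step_of_getElem 18 rfl [encCode f, encCont k, encNat n, encList v]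
        (by simp [encCont, encList, encNat]) (by simp [encCont]))
        (reaches_stepNormal f (.fix f k) v)

theorem reaches_done_of_dom {c : Code} {v : List ℕ} (h : (c.eval v).Dom) :
    system.Reaches (run (encCode c) (encCont .halt) (encList v)) done := by
  obtain ⟨w, hw⟩ := Part.dom_iff_mem.1 h
  have hmem : Cfg.halt w ∈ StateTransition.eval step (stepNormal c Cont.halt v) := by
    rw [stepNormal_eval]
    exact Part.mem_map _ hw
  have hreach : ∀ {x y : Cfg}, StateTransition.Reaches step x y →
      system.Reaches (encCfg x) (encCfg y) := by
    intro x y hxy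
    induction hxy with
    | refl => exact .refl
    | @tail y z _ hyz ih =>
      cases y with
      | halt v => cases hyz
      | ret k v =>
        obtain rfl : stepRet k v = z := Option.some.inj hyz
        exact ih.trans (reaches_stepRet k v)
  exact (reaches_stepNormal c _ v).trans (hreach (StateTransition.mem_eval.1 hmem).1)

/-! ### Confluence -/

/-- The indices below 3 are `run`, `ret` and `done`. Thus no other root is a redex, and contracting
a redex stays among these roots or gives `stuck`. -/
theorem roots_of_mem_rules :
    ∀ ρ ∈ rules, (∃ i < 3, ∃ ts h, ρ.1 = app i ts h) ∧
      (ρ.2 = stuck ∨ ∃ i < 3, ∃ ts h, ρ.2 = app i ts h) := by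
  have hrun : ∀ c k v, ∃ i < 3, ∃ ts h, run c k v = app i ts h :=
    fun c k v => ⟨0, by norm_num, _, _, rfl⟩
  have hret : ∀ k v, ∃ i < 3, ∃ ts h, ret k v = app i ts h :=
    fun k v => ⟨1, by norm_num, _, _, rfl⟩
  have hdone : ∃ i < 3, ∃ ts h, done = app i ts h := ⟨2, by norm_num, _, _, rfl⟩
  simp only [rules, List.forall_mem_cons, hrun, hret, hdone, or_true, and_true, true_or]
  simp

theorem exists_root_of_mem_rules {ρ : T × T} (hρ : ρ ∈ rules) (θ : ℕ → T) :
    (∃ i < 3, ∃ ts h, ρ.1.subst θ = app i ts h) ∧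
      (ρ.2.subst θ = stuck ∨ ∃ i < 3, ∃ ts h, ρ.2.subst θ = app i ts h) := by
  obtain ⟨⟨i, hi, ts, h, hl⟩, hr⟩ := roots_of_mem_rules ρ hρ
  refine ⟨⟨i, hi, _, _, by rw [hl, subst_app]⟩, ?_⟩
  rcases hr with hr | ⟨j, hj, us, h', hr⟩
  · exact .inl (by rw [hr]; simp)
  · exact .inr ⟨j, hj, _, _, by rw [hr, subst_app]⟩

theorem step_app_cases_of_three_le {i : ℕ} {ts : List T} {h : arities[i]? = some ts.length}
    {t' : T} (hi : 3 ≤ i) (hs : system.Step (app i ts h) t') :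
    ∃ p u u' q h', ts = p ++ u :: q ∧ system.Step u u' ∧ t' = app i (p ++ u' :: q) h' := by
  rcases hs.app_cases with ⟨ρ, hρ, θ, hl, -⟩ | h
  · obtain ⟨⟨j, hj, us, h', hus⟩, -⟩ := exists_root_of_mem_rules hρ θ
    rw [hus, app_inj] at hl
    omega
  · exact h

theorem not_step_app {i : ℕ} {ts : List T} {h : arities[i]? = some ts.length} (hi : 3 ≤ i)
    (hts : ∀ u ∈ ts, ∀ u', ¬ system.Step u u') (t' : T) : ¬ system.Step (app i ts h) t' := by
  intro hs
  obtain ⟨p, u, u', q, h', rfl, hu, -⟩ := step_app_cases_of_three_le hi hs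
  exact hts u (by simp) u' hu

theorem not_step_stuck (t' : T) : ¬ system.Step stuck t' :=
  not_step_app (by norm_num) (by
    simp only [List.mem_singleton, forall_eq]
    exact not_step_app le_rfl (by simp)) t'

/-- Terms that may be rewritten to `stuck`. -/
def Active (t : T) : Prop := t = stuck ∨ ∃ i < 3, ∃ ts h, t = app i ts h

theorem Active.reaches_stuck {t : T} (ht : Active t) : system.Reaches t stuck := by
  rcases ht with rfl | ⟨i, hi, ts, h, rfl⟩
  · exact .refl
  · refine .single ?_
    interval_cases i
    · obtain ⟨c, k, v, rfl⟩ := List.length_eq_three.1 (Option.some.inj h).symm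
      exact step_of_getElem 19 rfl [c, k, v] (by simp) (by simp)
    · obtain ⟨k, v, rfl⟩ := List.length_eq_two.1 (Option.some.inj h).symm
      exact step_of_getElem 20 rfl [k, v] (by simp) (by simp)
    · obtain rfl := List.length_eq_zero_iff.1 (Option.some.inj h).symm
      exact step_of_getElem 21 rfl [] (by simp) (by simp)

theorem Active.step {t t' : T} (ht : Active t) (hs : system.Step t t') : Active t' := by
  rcases ht with rfl | ⟨i, hi, ts, h, rfl⟩
  · exact (not_step_stuck _ hs).elim
  · rcases hs.app_cases with ⟨ρ, hρ, θ, -, rfl⟩ | ⟨p, u, u', q, h', -, -, rfl⟩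
    · exact (exists_root_of_mem_rules hρ θ).2
    · exact .inr ⟨i, hi, _, _, rfl⟩

theorem Active.reaches {t t' : T} (ht : Active t) (hs : system.Reaches t t') : Active t' := by
  induction hs with
  | refl => exact ht
  | tail _ hs ih => exact ih.step hs

theorem forall₂_trans {α : Type*} {r : α → α → Prop} [IsTrans α r] {l₁ l₂ l₃ : List α}
    (h₁ : List.Forall₂ r l₁ l₂) (h₂ : List.Forall₂ r l₂ l₃) : List.Forall₂ r l₁ l₃ := by
  induction h₁ generalizing l₃ with
  | nil => exact h₂
  | cons h _ ih =>
    cases h₂ with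
    | cons h' h₂ => exact .cons (_root_.trans h h') (ih h₂)

/-- A root with index at least 3 is never touched, so all steps take place inside the arguments. -/
theorem reaches_app_cases {i : ℕ} {ts : List T} {h : arities[i]? = some ts.length} {t' : T}
    (hi : 3 ≤ i) (hs : system.Reaches (app i ts h) t') :
    ∃ us h', t' = app i us h' ∧ List.Forall₂ system.Reaches ts us := by
  induction hs with
  | refl => exact ⟨ts, h, rfl, List.forall₂_same.2 fun _ _ => .refl⟩
  | tail _ hs ih =>
    obtain ⟨us, h', rfl, hus⟩ := ih
    obtain ⟨p, u, u', q, h₂, rfl, hu, rfl⟩ := step_app_cases_of_three_le hi hs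
    have : IsTrans T system.Reaches := ⟨fun _ _ _ => Relation.ReflTransGen.trans⟩
    refine ⟨_, h₂, rfl, forall₂_trans hus ?_⟩
    refine List.rel_append (List.forall₂_same.2 fun _ _ => .refl) (.cons (.single hu)
      (List.forall₂_same.2 fun _ _ => .refl))

theorem exists_forall₂_reaches {R : TRS (sig arities)} {ts us₁ us₂ : List T}
    (hts : ∀ t ∈ ts, ∀ u₁ u₂, R.Reaches t u₁ → R.Reaches t u₂ → R.Joinable u₁ u₂)
    (h₁ : List.Forall₂ R.Reaches ts us₁) (h₂ : List.Forall₂ R.Reaches ts us₂) :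
    ∃ ws, List.Forall₂ R.Reaches us₁ ws ∧ List.Forall₂ R.Reaches us₂ ws := by
  induction h₁ generalizing us₂ with
  | nil =>
    cases h₂
    exact ⟨[], .nil, .nil⟩
  | cons h _ ih =>
    cases h₂ with
    | cons h' h₂ =>
      obtain ⟨ws, hw₁, hw₂⟩ := ih (fun t ht => hts t (List.mem_cons_of_mem _ ht)) h₂
      obtain ⟨w, hw, hw'⟩ := hts _ List.mem_cons_self _ _ h h'
      exact ⟨w :: ws, .cons hw hw₁, .cons hw' hw₂⟩

/-- Reducts of an active term are active and meet at `stuck`. Otherwise the root is frozen, and the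
induction hypothesis joins the arguments one by one. -/
theorem confluent_system : system.Confluent := by
  intro s
  induction s using app_induction with
  | hvar x =>
    intro s₁ s₂ h₁ h₂
    have : ∀ s, system.Reaches (Term.var x) s → s = Term.var x := fun s hs => by
      rcases Relation.ReflTransGen.cases_head hs with rfl | ⟨u, hu, -⟩
      · rfl
      · exact (TRS.not_step_var x u hu).elim
    rw [this s₁ h₁, this s₂ h₂]
    exact ⟨_, .refl, .refl⟩
  | happ i ts h ih =>
    intro s₁ s₂ h₁ h₂
    rcases lt_or_ge i 3 with hi | hi
    · have ha : Active (app i ts h) := .inr ⟨i, hi, ts, h, rfl⟩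
      exact ⟨stuck, (ha.reaches h₁).reaches_stuck, (ha.reaches h₂).reaches_stuck⟩
    · obtain ⟨us₁, h₁', rfl, hus₁⟩ := reaches_app_cases hi h₁
      obtain ⟨us₂, h₂', rfl, hus₂⟩ := reaches_app_cases hi h₂
      obtain ⟨ws, hw₁, hw₂⟩ := exists_forall₂_reaches ih hus₁ hus₂
      have hws : arities[i]? = some ws.length := by rw [h₁', hw₁.length_eq]
      exact ⟨app i ws hws, TRS.reaches_app_of_forall₂ hw₁ [] h₁' hws,
        TRS.reaches_app_of_forall₂ hw₂ [] h₂' hws⟩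

/-! ### Diverging computations never reach a term of size 1 -/

theorem not_step_encNat (n : ℕ) (t : T) : ¬ system.Step (encNat n) t := by
  induction n generalizing t with rw [encNat]
  | zero => exact not_step_app (by norm_num) (by simp) t
  | succ n ih => exact not_step_app (by norm_num) (by simpa using ih) t

theorem not_step_encList (v : List ℕ) (t : T) : ¬ system.Step (encList v) t := by
  induction v generalizing t with rw [encList]
  | nil => exact not_step_app (by norm_num) (by simp) t
  | cons n v ih => exact not_step_app (by norm_num) (by simpa using ⟨not_step_encNat n, ih⟩) t

theorem not_step_encCode (c : Code) (t : T) : ¬ system.Step (encCode c) t := by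
  induction c generalizing t with rw [encCode]
  | zero' | succ | tail => exact not_step_app (by norm_num) (by simp) t
  | cons f g ihf ihg | comp f g ihf ihg | case f g ihf ihg =>
    exact not_step_app (by norm_num) (by simpa using ⟨ihf, ihg⟩) t
  | fix f ih => exact not_step_app (by norm_num) (by simpa using ih) t

theorem not_step_encCont (k : Cont) (t : T) : ¬ system.Step (encCont k) t := by
  induction k generalizing t with rw [encCont]
  | halt => exact not_step_app (by norm_num) (by simp) t
  | cons₁ f v k ih =>
    exact not_step_app (by norm_num) (by simpa using ⟨not_step_encCode f, not_step_encList v, ih⟩) t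
  | cons₂ v k ih => exact not_step_app (by norm_num) (by simpa using ⟨not_step_encList v, ih⟩) t
  | comp f k ih | fix f k ih =>
    exact not_step_app (by norm_num) (by simpa using ⟨not_step_encCode f, ih⟩) t

/-- The term encodes a diverging configuration of the machine, or is `stuck`. -/
inductive Diverges : T → Prop
  | stuck : Diverges stuck
  | run {c k v} (h : ¬ (StateTransition.eval step (stepNormal c k v)).Dom) :
      Diverges (run (encCode c) (encCont k) (encList v))
  | ret {k v} (h : ¬ (StateTransition.eval step (stepRet k v)).Dom) :
      Diverges (ret (encCont k) (encList v))

theorem eval_ret (k : Cont) (v : List ℕ) :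
    StateTransition.eval step (Cfg.ret k v) = StateTransition.eval step (stepRet k v) :=
  StateTransition.reaches_eval (.single rfl)

theorem Diverges.of_ret {k : Cont} {v : List ℕ}
    (h : ¬ (StateTransition.eval step (Cfg.ret k v)).Dom) :
    Diverges (Machine.ret (encCont k) (encList v)) :=
  .ret (eval_ret k v ▸ h)

/-- Apart from the collapse, a rule that matches an encoded configuration follows the recursion of
`stepNormal`, so `hd` is by unfolding also the divergence of the next configuration. -/
theorem diverges_of_run_eq {c : Code} {k : Cont} {v : List ℕ}
    (hd : ¬ (StateTransition.eval step (stepNormal c k v)).Dom) {ρ : T × T} (hρ : ρ ∈ rules)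
    {θ : ℕ → T} (h : ρ.1.subst θ = run (encCode c) (encCont k) (encList v)) :
    Diverges (ρ.2.subst θ) := by
  simp only [rules, List.mem_cons, List.not_mem_nil, or_false] at hρ
  rcases hρ with rfl | rfl | rfl | rfl | rfl | rfl | rfl | rfl | rfl | rfl | rfl | rfl | rfl | rfl |
    rfl | rfl | rfl | rfl | rfl | rfl | rfl | rfl <;>
    -- This removes the rules whose root is not `run`.
    simp at h
  · cases c <;> simp [encCode] at h
    simp only [subst_app, List.map_cons, List.map_nil, Term.subst, h]
    exact .of_ret (v := 0 :: v) hd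
  · cases c <;> simp [encCode] at h
    rcases v with _ | ⟨n, v⟩ <;> simp [encList] at h
    simp only [subst_app, List.map_cons, List.map_nil, Term.subst, h]
    -- The head of the empty list counts as 0, whose successor is 1.
    exact .of_ret (v := [1]) hd
  · cases c <;> simp [encCode] at h
    rcases v with _ | ⟨n, v⟩ <;> simp [encList] at h
    simp only [subst_app, List.map_cons, List.map_nil, Term.subst, h]
    exact .of_ret (v := [n + 1]) hd
  · cases c <;> simp [encCode] at h
    rcases v with _ | ⟨n, v⟩ <;> simp [encList] at h
    simp only [subst_app, List.map_cons, List.map_nil, Term.subst, h]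
    exact .of_ret (v := []) hd
  · cases c <;> simp [encCode] at h
    rcases v with _ | ⟨n, v⟩ <;> simp [encList] at h
    simp only [subst_app, List.map_cons, List.map_nil, Term.subst, h]
    exact .of_ret (v := v) hd
  · rcases c with _ | _ | _ | ⟨f, g⟩ | _ | _ | _ <;> simp [encCode] at h
    simp only [subst_app, List.map_cons, List.map_nil, Term.subst, h]
    exact .run (k := .cons₁ g v k) hd
  · rcases c with _ | _ | _ | _ | ⟨f, g⟩ | _ | _ <;> simp [encCode] at h
    simp only [subst_app, List.map_cons, List.map_nil, Term.subst, h]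
    exact .run (k := .comp f k) hd
  · rcases c with _ | _ | _ | _ | _ | ⟨f, g⟩ | _ <;> simp [encCode] at h
    rcases v with _ | ⟨n, v⟩ <;> simp [encList] at h
    simp only [subst_app, List.map_cons, List.map_nil, Term.subst, h]
    exact .run (v := []) hd
  · rcases c with _ | _ | _ | _ | _ | ⟨f, g⟩ | _ <;> simp [encCode] at h
    rcases v with _ | ⟨_ | n, v⟩ <;> simp [encList, encNat] at h
    simp only [subst_app, List.map_cons, List.map_nil, Term.subst, h]
    exact .run (v := v) hd
  · rcases c with _ | _ | _ | _ | _ | ⟨f, g⟩ | _ <;> simp [encCode] at h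
    rcases v with _ | ⟨_ | n, v⟩ <;> simp [encList, encNat] at h
    simp only [subst_app, List.map_cons, List.map_nil, Term.subst, h]
    exact .run (v := n :: v) hd
  · rcases c with _ | _ | _ | _ | _ | _ | ⟨f⟩ <;> simp [encCode] at h
    simp only [subst_app, List.map_cons, List.map_nil, Term.subst, h]
    exact .run (k := .fix f k) hd
  · simp only [subst_app, List.map_cons, List.map_nil]
    exact .stuck

theorem diverges_of_ret_eq {k : Cont} {v : List ℕ}
    (hd : ¬ (StateTransition.eval step (stepRet k v)).Dom) {ρ : T × T} (hρ : ρ ∈ rules)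
    {θ : ℕ → T} (h : ρ.1.subst θ = ret (encCont k) (encList v)) :
    Diverges (ρ.2.subst θ) := by
  simp only [rules, List.mem_cons, List.not_mem_nil, or_false] at hρ
  rcases hρ with rfl | rfl | rfl | rfl | rfl | rfl | rfl | rfl | rfl | rfl | rfl | rfl | rfl | rfl |
    rfl | rfl | rfl | rfl | rfl | rfl | rfl | rfl <;>
    simp at h
  · rcases k with _ | _ | _ | _ | _ <;> simp [encCont] at h
    -- The rule leading to `done` cannot apply, because the halting continuation makes the
    -- evaluation defined.
    exact (hd (Part.dom_iff_mem.2 ⟨_, StateTransition.mem_eval.2 ⟨.refl, rfl⟩⟩)).elim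
  · rcases k with _ | ⟨f, as, k⟩ | _ | _ | _ <;> simp [encCont] at h
    simp only [subst_app, List.map_cons, List.map_nil, Term.subst, h]
    exact .run (k := .cons₂ v k) hd
  · rcases k with _ | _ | ⟨_ | ⟨n, ns⟩, k⟩ | _ | _ <;> simp [encCont, encList] at h
    simp only [subst_app, List.map_cons, List.map_nil, Term.subst, h]
    exact .ret (v := 0 :: v) hd
  · rcases k with _ | _ | ⟨_ | ⟨n, ns⟩, k⟩ | _ | _ <;> simp [encCont, encList] at h
    simp only [subst_app, List.map_cons, List.map_nil, Term.subst, h]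
    exact .ret (v := n :: v) hd
  · rcases k with _ | _ | _ | ⟨f, k⟩ | _ <;> simp [encCont] at h
    simp only [subst_app, List.map_cons, List.map_nil, Term.subst, h]
    exact .run hd
  · rcases k with _ | _ | _ | _ | ⟨f, k⟩ <;> simp [encCont] at h
    rcases v with _ | ⟨n, v⟩ <;> simp [encList] at h
    simp only [subst_app, List.map_cons, List.map_nil, Term.subst, h]
    exact .ret (v := []) hd
  · rcases k with _ | _ | _ | _ | ⟨f, k⟩ <;> simp [encCont] at h
    rcases v with _ | ⟨_ | n, v⟩ <;> simp [encList, encNat] at h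
    simp only [subst_app, List.map_cons, List.map_nil, Term.subst, h]
    exact .ret (v := v) hd
  · rcases k with _ | _ | _ | _ | ⟨f, k⟩ <;> simp [encCont] at h
    rcases v with _ | ⟨_ | n, v⟩ <;> simp [encList, encNat] at h
    simp only [subst_app, List.map_cons, List.map_nil, Term.subst, h]
    exact .run (k := .fix f k) (v := v) hd
  · simp only [subst_app, List.map_cons, List.map_nil]
    exact .stuck

/-- Encoded codes, continuations and lists are normal forms, so only steps at the root are possible.
-/
theorem Diverges.step {t t' : T} (ht : Diverges t) (hs : system.Step t t') : Diverges t' := by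
  cases ht with
  | stuck => exact (not_step_stuck _ hs).elim
  | @run c k v hd =>
    rcases hs.app_cases with ⟨ρ, hρ, θ, h, rfl⟩ | ⟨p, u, u', q, -, hp, hu, -⟩
    · exact diverges_of_run_eq hd hρ h.symm
    · have hmem : u ∈ [encCode c, encCont k, encList v] := by simp [hp]
      simp only [List.mem_cons, List.not_mem_nil, or_false] at hmem
      rcases hmem with rfl | rfl | rfl
      · exact (not_step_encCode _ _ hu).elim
      · exact (not_step_encCont _ _ hu).elim
      · exact (not_step_encList _ _ hu).elim
  | @ret k v hd =>
    rcases hs.app_cases with ⟨ρ, hρ, θ, h, rfl⟩ | ⟨p, u, u', q, -, hp, hu, -⟩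
    · exact diverges_of_ret_eq hd hρ h.symm
    · have hmem : u ∈ [encCont k, encList v] := by simp [hp]
      simp only [List.mem_cons, List.not_mem_nil, or_false] at hmem
      rcases hmem with rfl | rfl
      · exact (not_step_encCont _ _ hu).elim
      · exact (not_step_encList _ _ hu).elim

theorem termSize_pos {σ : List ℕ} (t : Tm (sig σ)) : 0 < termSize t := by
  rw [← length_encodeTerm]
  exact List.length_pos_iff.2 (encodeTerm_ne_nil t)

theorem termSize_app {σ : List ℕ} (i : ℕ) (ts : List (Tm (sig σ)))
    (h : σ[i]? = some ts.length) : termSize (app i ts h) = 1 + (ts.map termSize).sum := by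
  rw [← length_encodeTerm, encodeTerm_app]
  simp [List.length_flatMap, length_encodeTerm, add_comm]

/-- This is why `stuck` is `succ zero` and not a constant. -/
theorem Diverges.one_lt_termSize {t : T} (ht : Diverges t) : 1 < termSize t := by
  cases ht with
  | stuck => simp [termSize_app]
  | @run c k v => simp [termSize_app, termSize_pos]
  | @ret k v => simp [termSize_app, termSize_pos]

theorem smallTermReachable_iff {c : Code} {v : List ℕ} :
    system.SmallTermReachable (run (encCode c) (encCont .halt) (encList v)) 1 ↔
      (c.eval v).Dom := by
  constructor
  · rintro ⟨t, ht, hle⟩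
    by_contra hd
    have h₀ : Diverges (run (encCode c) (encCont .halt) (encList v)) :=
      .run (by rw [stepNormal_eval]; exact hd)
    have : Diverges t := by
      clear hle
      induction ht with
      | refl => exact h₀
      | tail _ hs ih => exact ih.step hs
    exact hle.not_gt this.one_lt_termSize
  · exact fun h => ⟨done, reaches_done_of_dom h, by simp [termSize_app]⟩

/-! ### Reduction from the halting problem -/

theorem exists_code_not_computablePred :
    ∃ c : Code, ¬ ComputablePred fun n : ℕ => (c.eval [n]).Dom := by
  -- A universal function: it is defined at `n` exactly when the program with number `n` halts on 0.
  -- With its code fixed, only a numeral varies in the reduction.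
  let f : ℕ →. ℕ := fun n => Nat.Partrec.Code.eval (Denumerable.ofNat Nat.Partrec.Code n) 0
  have hf : Partrec f :=
    Nat.Partrec.Code.eval_part.comp (Computable.ofNat _) (Computable.const 0)
  obtain ⟨c, hc⟩ := Code.exists_code (Nat.Partrec'.part_iff₁.2 hf)
  refine ⟨c, fun h => ComputablePred.halting_problem 0 ?_⟩
  refine ComputablePred.computable_of_manyOneReducible
    ⟨Encodable.encode, Computable.encode, fun d => ?_⟩ h
  have := hc (Encodable.encode d ::ᵥ List.Vector.nil)
  change c.eval [Encodable.encode d] = _ at this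
  rw [this]
  simp [f]

/-- Writing the word as an iteration makes its primitive recursiveness in `n` immediate. -/
theorem encodeTerm_encNat (n : ℕ) :
    encodeTerm (encNat n) = (List.cons (Sum.inr 4))^[n] [Sum.inr 3] := by
  induction n with
  | zero => simp [encNat, encodeTerm_app]
  | succ n ih =>
    simp [encNat, encodeTerm_app, ih, Function.iterate_succ_apply', -Function.iterate_succ]

theorem not_smallTermReachabilityDecidable : ¬ system.SmallTermReachabilityDecidable := by
  intro h
  obtain ⟨c, hc⟩ := exists_code_not_computablePred
  refine hc (ComputablePred.computable_of_manyOneReducible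
    ⟨fun n => (encodeTerm (run (encCode c) (encCont .halt) (encList [n])), 1), ?_, fun n => ?_⟩ h)
  · have hn : Primrec fun n : ℕ => encodeTerm (encNat n) := by
      simp only [encodeTerm_encNat]
      exact Primrec.nat_iterate Primrec.id (Primrec.const _)
        (Primrec.list_cons.comp (Primrec.const _) Primrec.snd).to₂
    -- The letters 0, 14, 6 and 5 are the indices of `run`, `contHalt`, `cons` and `nil`.
    have : Primrec fun n : ℕ => (Sum.inr 0 :: (encodeTerm (encCode c) ++
        Sum.inr 14 :: Sum.inr 6 :: (encodeTerm (encNat n) ++ [Sum.inr 5])) : Word) :=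
      Primrec.list_cons.comp (Primrec.const _) (Primrec.list_append.comp (Primrec.const _)
        (Primrec.list_cons.comp (Primrec.const _) (Primrec.list_cons.comp (Primrec.const _)
          (Primrec.list_append.comp hn (Primrec.const _)))))
    refine ((this.pair (Primrec.const 1)).of_eq fun n => ?_).to_comp
    simp [encodeTerm_app, encCont, encList]
  · simp only
    rw [← smallTermReachable_iff]
    refine ⟨fun h => ⟨_, rfl, h⟩, ?_⟩
    rintro ⟨s, hs, h⟩
    rwa [← encodeTerm_injective hs]

end Machine

end TermRewriting

theorem mainTheorem10 :
    (∃ (σ : List ℕ) (R : TermRewriting.TRS (TermRewriting.sig σ)),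
      R.Confluent ∧ ¬ R.SmallTermReachabilityDecidable) ∧
    (∀ (σ : List ℕ) (R : TermRewriting.TRS (TermRewriting.sig σ)), R.Terminating →
      (∀ s, {t | R.Reaches s t}.Finite) ∧ R.SmallTermReachabilityDecidable) ∧
    (∃ decider : List ℕ × List (TermRewriting.Word × TermRewriting.Word) ×
          TermRewriting.Word × ℕ →. Bool,
      Partrec decider ∧
      ∀ (σ : List ℕ) (R : TermRewriting.TRS (TermRewriting.sig σ)), R.Terminating →
        ∀ (s : TermRewriting.Tm (TermRewriting.sig σ)) (n : ℕ),
          ∃ b ∈ decider (σ, R.encode, TermRewriting.encodeTerm s, n),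
            b = true ↔ R.SmallTermReachable s n) :=
  ⟨⟨_, TermRewriting.Machine.system, TermRewriting.Machine.confluent_system,
      TermRewriting.Machine.not_smallTermReachabilityDecidable⟩,
    fun _ _ hR => ⟨hR.finite_reaches, hR.smallTermReachabilityDecidable⟩,
    TermRewriting.smallTermDecider, TermRewriting.partrec_smallTermDecider,
    fun _ _ hR => hR.smallTermDecider_spec⟩
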